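/- Let $M$ be a closed hyperbolic $3$-manifold, that is, a compact quotient of $\mathbb H^3$ by a group of isometries acting freely and properly discontinuously, with universal covering $p\colon \mathbb H^3\to M$. Let $X\colon \mathbb R\times M\to M$ be a $C^1$ flow, i.e. a $C^1$ map with $X(0,m)=m$ and $X(t,X(s,m))=X(t+s,m)$. A lifted flowline is the image $l$ of a continuous curve $c\colon\mathbb R\to\mathbb H^3$ with $p(c(t))=X(t,p(c(0)))$ for all $t$; it carries its induced length metric $d_l$, the distance of two points being the infimum of the lengths of the arcs of $l$ joining them. For a real number $k\ge 1$, the lifted flowline $l$ is called a $k$-quasigeodesic if $(l,d_l)$ is isometric to $\mathbb R$ and for all $x,y\in l$ $$\frac1k\,d_{\mathbb H^3}(x,y)-k\;\le\; d_l(x,y)\;\le\; k\,d_{\mathbb H^3}(x,y)+k .$$ Suppose that $X$ is quasigeodesic: every lifted flowline is a $k$-quasigeodesic for some $k\ge1$, which may depend on the flowline. Then $X$ is uniformly quasigeodesic: there is a single $k\ge 1$ such that every lifted flowline is a $k$-quasigeodesic. -/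

import Mathlib

open scoped Manifold ContDiff Topology

noncomputable section

/-! ### Hyperbolic 3-space: the upper half-space model -/

/-- Hyperbolic 3-space, as the set of points of Euclidean 3-space with positive last coordinate. -/
@[ext]
structure HypSpace where
  /-- the underlying point of Euclidean 3-space -/
  coe : EuclideanSpace ℝ (Fin 3)
  pos : 0 < coe 2

namespace HypSpace

/-- The height (last coordinate) of a point. -/
def height (x : HypSpace) : ℝ := x.coe 2

theorem height_pos (x : HypSpace) : 0 < x.height := x.pos

/-- The mirror image of a point in the boundary plane. -/
def mirror (x : HypSpace) : EuclideanSpace ℝ (Fin 3) := !₂[x.coe 0, x.coe 1, -x.coe 2]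

/-- The hyperbolic distance; `cosh_dist` gives the familiar formula
`cosh d(x,y) = 1 + |x - y|² / (2 x₃ y₃)`. -/
instance : Dist HypSpace :=
  ⟨fun x y => 2 * Real.arsinh (dist x.coe y.coe / (2 * √(x.height * y.height)))⟩

theorem dist_eq (x y : HypSpace) :
    dist x y = 2 * Real.arsinh (dist x.coe y.coe / (2 * √(x.height * y.height))) := rfl

theorem sqrt_pos (x y : HypSpace) : 0 < √(x.height * y.height) :=
  Real.sqrt_pos.2 (mul_pos x.height_pos y.height_pos)

theorem sinh_half_dist (x y : HypSpace) :
    Real.sinh (dist x y / 2) = dist x.coe y.coe / (2 * √(x.height * y.height)) := by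
  rw [dist_eq, mul_div_cancel_left₀ _ two_ne_zero, Real.sinh_arsinh]

theorem cosh_dist (x y : HypSpace) :
    Real.cosh (dist x y) = 1 + dist x.coe y.coe ^ 2 / (2 * x.height * y.height) := by
  have hx := x.height_pos
  have hy := y.height_pos
  have h : Real.cosh (dist x y) = 1 + 2 * Real.sinh (dist x y / 2) ^ 2 := by
    have h1 := Real.cosh_two_mul (dist x y / 2)
    rw [mul_div_cancel₀ _ (two_ne_zero' ℝ), Real.cosh_sq] at h1
    linarith
  rw [h, sinh_half_dist, div_pow, mul_pow, Real.sq_sqrt (mul_pos hx hy).le]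
  field_simp

theorem dist_mirror_sq (x y : HypSpace) :
    dist x.coe y.mirror ^ 2 = dist x.coe y.coe ^ 2 + 4 * (x.height * y.height) := by
  simp [EuclideanSpace.dist_sq_eq, Fin.sum_univ_three, mirror, height, Real.dist_eq, sq_abs]
  ring

theorem dist_coe_mirror_comm (x y : HypSpace) : dist x.coe y.mirror = dist y.coe x.mirror := by
  rw [← sq_eq_sq₀ dist_nonneg dist_nonneg, dist_mirror_sq, dist_mirror_sq, dist_comm x.coe]
  ring

theorem dist_self_mirror (x : HypSpace) : dist x.coe x.mirror = 2 * x.height := by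
  have hx := x.height_pos
  rw [← sq_eq_sq₀ dist_nonneg (by positivity), dist_mirror_sq, dist_self]
  ring

theorem cosh_half_dist (x y : HypSpace) :
    Real.cosh (dist x y / 2) = dist x.coe y.mirror / (2 * √(x.height * y.height)) := by
  have hs := sqrt_pos x y
  rw [← sq_eq_sq₀ (Real.cosh_pos _).le (by positivity), Real.cosh_sq', sinh_half_dist, div_pow,
    div_pow, dist_mirror_sq, mul_pow, Real.sq_sqrt (mul_pos x.height_pos y.height_pos).le]
  have hx := x.height_pos
  have hy := y.height_pos
  field_simp
  ring

protected theorem dist_comm (x y : HypSpace) : dist x y = dist y x := by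
  rw [dist_eq, dist_eq, dist_comm x.coe, mul_comm x.height]

protected theorem dist_triangle (x y z : HypSpace) : dist x z ≤ dist x y + dist y z := by
  have hx := x.height_pos
  have hy := y.height_pos
  have hz := z.height_pos
  have key := EuclideanGeometry.mul_dist_le_mul_dist_add_mul_dist x.coe y.coe z.coe y.mirror
  rw [dist_self_mirror] at key
  rw [← div_le_div_iff_of_pos_right (zero_lt_two' ℝ), ← Real.sinh_le_sinh, add_div, Real.sinh_add,
    sinh_half_dist, sinh_half_dist, sinh_half_dist, cosh_half_dist, cosh_half_dist,
    dist_coe_mirror_comm y z, Real.sqrt_mul hx.le, Real.sqrt_mul hx.le, Real.sqrt_mul hy.le]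
  have sx := Real.sqrt_pos.2 hx
  have sy := Real.sqrt_pos.2 hy
  have sz := Real.sqrt_pos.2 hz
  have hyy : √y.height * √y.height = y.height := Real.mul_self_sqrt hy.le
  rw [div_mul_div_comm, div_mul_div_comm,
    show 2 * (√x.height * √y.height) * (2 * (√y.height * √z.height))
      = 4 * (√x.height * √z.height) * (√y.height * √y.height) by ring, hyy, ← add_div,
    div_le_div_iff₀ (by positivity) (by positivity)]
  have : 0 < √x.height * √z.height := by positivity
  nlinarith [mul_le_mul_of_nonneg_left key this.le]

/-- The upper half-space with its hyperbolic metric. -/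
instance : MetricSpace HypSpace where
  dist_self x := by simp [dist_eq]
  dist_comm := HypSpace.dist_comm
  dist_triangle := HypSpace.dist_triangle
  eq_of_dist_eq_zero {x y} h := by
    have hs := sqrt_pos x y
    rw [dist_eq, mul_eq_zero, Real.arsinh_eq_zero_iff, div_eq_zero_iff] at h
    rcases h with h | h | h
    · norm_num at h
    · exact HypSpace.ext (dist_eq_zero.1 h)
    · linarith

theorem dist_coe_le (x y : HypSpace) :
    dist x.coe y.coe ≤ x.height * (Real.exp (dist x y) - 1) := by
  have hx := x.height_pos
  have hy := y.height_pos
  set r := dist x.coe y.coe with hr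
  set s := Real.sinh (dist x y / 2) with hs
  set c := Real.cosh (dist x y / 2) with hc
  have hr0 : 0 ≤ r := dist_nonneg
  have hs0 : 0 ≤ s := Real.sinh_nonneg_iff.2 (by positivity)
  have hc0 : 0 < c := Real.cosh_pos _
  have hcs : c ^ 2 = s ^ 2 + 1 := Real.cosh_sq _
  have hexp : Real.exp (dist x y) - 1 = 2 * s * (s + c) := by
    have h1 : Real.exp (dist x y) = (s + c) ^ 2 := by
      rw [hs, hc, Real.sinh_add_cosh, ← Real.exp_nat_mul]
      congr 1
      push_cast
      ring
    rw [h1]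
    linear_combination hcs
  have hrs : r ^ 2 = 4 * s ^ 2 * (x.height * y.height) := by
    have hq := sqrt_pos x y
    rw [hs, sinh_half_dist, div_pow, mul_pow, Real.sq_sqrt (mul_pos hx hy).le]
    field_simp
    ring
  have hyx : y.height ≤ x.height + r := by
    have h1 : ‖(y.coe - x.coe) 2‖ ≤ ‖y.coe - x.coe‖ := PiLp.norm_apply_le _ _
    rw [← dist_eq_norm, dist_comm, ← hr, PiLp.sub_apply, Real.norm_eq_abs] at h1
    have h2 := (le_abs_self _).trans h1
    simp only [height]
    linarith
  have h3 : (r - 2 * s ^ 2 * x.height) ^ 2 ≤ (2 * s * c * x.height) ^ 2 := by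
    have h4 : r ^ 2 ≤ 4 * s ^ 2 * (x.height * (x.height + r)) := by
      rw [hrs]
      gcongr
    have h5 : (2 * s * c * x.height) ^ 2 = 4 * s ^ 2 * (s ^ 2 + 1) * x.height ^ 2 := by
      rw [← hcs]
      ring
    rw [h5]
    linarith
  have h6 := abs_le_of_sq_le_sq' h3 (by positivity)
  rw [hexp]
  linarith [h6.2]

theorem continuous_coe : Continuous coe := by
  rw [continuous_iff_continuousAt]
  intro x
  rw [ContinuousAt, tendsto_iff_dist_tendsto_zero]
  have h : Filter.Tendsto (fun y : HypSpace => x.height * (Real.exp (dist x y) - 1)) (𝓝 x)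
      (𝓝 (x.height * (Real.exp (dist x x) - 1))) :=
    Continuous.tendsto (by fun_prop) x
  rw [dist_self, Real.exp_zero, sub_self, mul_zero] at h
  refine squeeze_zero (fun _ => dist_nonneg) (fun y => ?_) h
  rw [dist_comm]
  exact dist_coe_le x y

theorem isInducing_coe : Topology.IsInducing coe := by
  refine Topology.isInducing_iff_nhds.2 fun x => le_antisymm continuous_coe.continuousAt.le_comap ?_
  have hc : ContinuousAt (fun z : EuclideanSpace ℝ (Fin 3) =>
      2 * Real.arsinh (dist z x.coe / (2 * √(z 2 * x.height)))) x.coe := by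
    have h0 : 2 * √(x.coe 2 * x.height) ≠ 0 := (mul_pos two_pos (sqrt_pos x x)).ne'
    have h1 : ContinuousAt (fun z : EuclideanSpace ℝ (Fin 3) =>
        dist z x.coe / (2 * √(z 2 * x.height))) x.coe :=
      ContinuousAt.div (by fun_prop) (by fun_prop) h0
    exact continuousAt_const.mul (Real.continuous_arsinh.continuousAt.comp h1)
  have h2 : Filter.Tendsto (fun y : HypSpace => dist y x) (Filter.comap coe (𝓝 x.coe)) (𝓝 0) := by
    have h3 := hc.tendsto.comp (Filter.tendsto_comap (f := HypSpace.coe))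
    simp only [dist_self, zero_div, Real.arsinh_zero, mul_zero] at h3
    exact h3
  have h4 : Filter.Tendsto id (Filter.comap coe (𝓝 x.coe)) (𝓝 x) :=
    tendsto_iff_dist_tendsto_zero.2 h2
  simpa [Filter.Tendsto] using h4

theorem isOpenEmbedding_coe : Topology.IsOpenEmbedding coe := by
  refine ⟨⟨isInducing_coe, fun x y h => HypSpace.ext h⟩, ?_⟩
  have : Set.range coe = {z : EuclideanSpace ℝ (Fin 3) | 0 < z 2} := by
    ext z
    exact ⟨fun ⟨x, hx⟩ => hx ▸ x.pos, fun hz => ⟨⟨z, hz⟩, rfl⟩⟩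
  rw [this]
  exact isOpen_lt continuous_const (by fun_prop)

instance : Nonempty HypSpace := ⟨⟨!₂[0, 0, 1], by simp⟩⟩

/-- The smooth structure of hyperbolic space: that of an open subset of Euclidean space. -/
instance : ChartedSpace (EuclideanSpace ℝ (Fin 3)) HypSpace :=
  isOpenEmbedding_coe.singletonChartedSpace

instance : IsManifold (𝓡 3) ∞ HypSpace :=
  isOpenEmbedding_coe.isManifold_singleton

end HypSpace

/-! ### Closed hyperbolic 3-manifolds -/

/-- `p` exhibits the smooth manifold `M` as a hyperbolic 3-manifold with universal cover
hyperbolic 3-space: `p` is a smooth covering map, and any two points of a fibre are interchanged by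
an isometry of hyperbolic space commuting with `p`. In other words `M` is the quotient of hyperbolic
space by a group of isometries (the deck group, isomorphic to `π₁(M)`) acting freely and properly
discontinuously. The manifold is closed when `M` is compact. -/
structure IsHyperbolicUniversalCover {M : Type*} [TopologicalSpace M]
    [ChartedSpace (EuclideanSpace ℝ (Fin 3)) M] (p : HypSpace → M) : Prop where
  surjective : Function.Surjective p
  isCoveringMap : IsCoveringMap p
  isLocalDiffeomorph : IsLocalDiffeomorph (𝓡 3) (𝓡 3) ∞ p
  exists_isometry : ∀ x y : HypSpace, p x = p y →
    ∃ g : HypSpace ≃ᵢ HypSpace, g x = y ∧ ∀ z, p (g z) = p z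

/-! ### Quasigeodesics -/

/-- `φ` is a `k` quasi-isometric embedding. -/
def IsQuasiIsometricEmbedding {X Y : Type*} [MetricSpace X] [MetricSpace Y] (k : ℝ) (φ : X → Y) :
    Prop :=
  1 ≤ k ∧ ∀ p q : X, 1 / k * dist (φ p) (φ q) - k ≤ dist p q ∧
    dist p q ≤ k * dist (φ p) (φ q) + k

/-- The induced length metric on the curve traced out by `c`: the infimum of the lengths of the
arcs of `c` that join the points `p` and `q` (in the extended nonnegative reals). -/
def curveDist {Y : Type*} [MetricSpace Y] (c : ℝ → Y) (p q : Y) : ENNReal :=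
  ⨅ (s : ℝ) (_ : c s = p) (t : ℝ) (_ : c t = q), eVariationOn c (Set.uIcc s t)

/-- The curve traced out by `c`, with its induced length metric, is a `k` quasigeodesic:
this metric space is isometric to `ℝ` (through `γ`, an isometry from `ℝ` onto it), and the
inclusion into the ambient space is a `k` quasi-isometric embedding. -/
def IsQuasigeodesicCurve {Y : Type*} [MetricSpace Y] (k : ℝ) (c : ℝ → Y) : Prop :=
  ∃ γ : ℝ → Y, Set.range γ = Set.range c ∧
    (∀ a b : ℝ, curveDist c (γ a) (γ b) = ENNReal.ofReal |a - b|) ∧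
    IsQuasiIsometricEmbedding k γ

/-! ### Flows -/

/-- The flow `X` is `C¹`, as a map `ℝ × M → M`. -/
def IsC1Flow {M : Type*} [TopologicalSpace M] [ChartedSpace (EuclideanSpace ℝ (Fin 3)) M]
    (X : Flow ℝ M) : Prop :=
  ContMDiff (𝓘(ℝ, ℝ).prod (𝓡 3)) (𝓡 3) 1 (fun z : ℝ × M => X z.1 z.2)

/-- `c` is a lift to the universal cover of a flowline of `X`, parametrized by the flow. -/
def IsLiftedFlowline {M : Type*} [TopologicalSpace M] (p : HypSpace → M) (X : Flow ℝ M)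
    (c : ℝ → HypSpace) : Prop :=
  Continuous c ∧ ∀ t : ℝ, p (c t) = X t (p (c 0))

/-- Each lifted flowline is a quasigeodesic, with a constant that may depend on the flowline. -/
def IsQuasigeodesicFlow {M : Type*} [TopologicalSpace M] (p : HypSpace → M) (X : Flow ℝ M) :
    Prop :=
  ∀ c : ℝ → HypSpace, IsLiftedFlowline p X c → ∃ k : ℝ, IsQuasigeodesicCurve k c

/-- There is one constant `k` for which each lifted flowline is a `k` quasigeodesic. -/
def IsUniformlyQuasigeodesicFlow {M : Type*} [TopologicalSpace M] (p : HypSpace → M)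
    (X : Flow ℝ M) : Prop :=
  ∃ k : ℝ, ∀ c : ℝ → HypSpace, IsLiftedFlowline p X c → IsQuasigeodesicCurve k c

end

/-! ### Coarse geometry of hyperbolic space -/

namespace HypSpace

/-! If the quasigeodesic constants degenerated along a sequence of flowlines, a limit flowline would
fail to be a quasigeodesic. As `M` is compact and the flow is `C¹`, lifted flowlines share a
Lipschitz constant (`exists_lipschitz`), and modulo deck transformations every sequence of them
converges along an ultrafilter to a lifted flowline (`exists_limit_flowline`).

The crux is `exists_gromovProduct_le`: the Gromov product of two points of a flowline, based at a
point between them, is bounded. Otherwise, recentre each bad segment at the point maximizing the sum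
of the distances to its two ends. Seen from there the ends tend to a common ideal point, and
maximality places the limit flowline in a horoball centred at it. `exists_lt_of_quasigeodesic`
forbids this: outside a horoball, Gromov products based at its centre decay only logarithmically in
length, so an excursion of a quasigeodesic out of a horoball has length bounded independently of the
horoball; a line confined to a horoball would make ever longer excursions out of deeper and deeper
concentric ones.

Consequently a segment with nearby ends stays in a bounded region, and a second limit argument gives
uniform properness (`exists_lt_dist`). Counting points sampled at equal time intervals then bounds
time affinely by distance (`exists_abs_sub_le`). Length is at most the Lipschitz constant times
time, so one constant serves all flowlines. -/

theorem dist_le_dist_coe_div (x y : HypSpace) :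
    dist x y ≤ dist x.coe y.coe / √(x.height * y.height) := by
  have hs := sqrt_pos x y
  have h : Real.arsinh (dist x.coe y.coe / (2 * √(x.height * y.height))) ≤
      dist x.coe y.coe / (2 * √(x.height * y.height)) := by
    rw [← Real.sinh_le_sinh, Real.sinh_arsinh]
    exact Real.self_le_sinh_iff.2 (by positivity)
  rw [dist_eq]
  calc _ ≤ 2 * (dist x.coe y.coe / (2 * √(x.height * y.height))) := by gcongr
    _ = _ := by field_simp

/-- Ptolemy's inequality in hyperbolic space. -/
theorem sinh_ptolemy (x y z w : HypSpace) :
    Real.sinh (dist x z / 2) * Real.sinh (dist y w / 2) ≤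
      Real.sinh (dist x y / 2) * Real.sinh (dist z w / 2) +
        Real.sinh (dist y z / 2) * Real.sinh (dist x w / 2) := by
  have key := EuclideanGeometry.mul_dist_le_mul_dist_add_mul_dist x.coe y.coe z.coe w.coe
  have hx := x.height_pos
  have hy := y.height_pos
  have hz := z.height_pos
  have hw := w.height_pos
  simp only [sinh_half_dist, Real.sqrt_mul hx.le, Real.sqrt_mul hy.le, Real.sqrt_mul hz.le]
  have sx := Real.sqrt_pos.2 hx
  have sy := Real.sqrt_pos.2 hy
  have sz := Real.sqrt_pos.2 hz
  have sw := Real.sqrt_pos.2 hw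
  -- All three products have the same denominator, so Euclidean Ptolemy carries over.
  set P := √x.height * √y.height * √z.height * √w.height with hP
  have hP0 : 0 < 4 * P := by positivity
  calc _ = dist x.coe z.coe * dist y.coe w.coe / (4 * P) := by rw [hP]; field_simp; ring
    _ ≤ (dist x.coe y.coe * dist z.coe w.coe + dist y.coe z.coe * dist x.coe w.coe) / (4 * P) := by
      gcongr
    _ = _ := by rw [hP]; field_simp; ring

/-- The four point condition: hyperbolic space is hyperbolic in the sense of Gromov. -/
theorem four_point (x y z w : HypSpace) :
    dist x z + dist y w ≤ max (dist x y + dist z w) (dist y z + dist x w) + 5 := by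
  by_cases h1 : dist x z ≤ 2
  · have := dist_triangle4 y z x w
    rw [dist_comm z x] at this
    linarith [le_max_right (dist x y + dist z w) (dist y z + dist x w)]
  by_cases h2 : dist y w ≤ 2
  · have := dist_triangle4 x y w z
    rw [dist_comm w z] at this
    linarith [le_max_left (dist x y + dist z w) (dist y z + dist x w)]
  push Not at h1 h2
  -- Replacing `sinh` by exponentials costs a factor 8 in all, and `8 ≤ exp (5 / 2)` accounts for
  -- the additive constant 5.
  have lower : ∀ a : ℝ, 2 < a → Real.exp (a / 2) / 4 ≤ Real.sinh (a / 2) := by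
    intro a ha
    rw [Real.sinh_eq, Real.exp_neg]
    have h3 : (2 : ℝ) ≤ Real.exp (a / 2) := by linarith [Real.add_one_le_exp (a / 2)]
    have h4 : (Real.exp (a / 2))⁻¹ ≤ 2⁻¹ := inv_anti₀ (by norm_num) h3
    linarith
  have upper : ∀ a : ℝ, Real.sinh (a / 2) ≤ Real.exp (a / 2) / 2 := by
    intro a
    rw [Real.sinh_eq]
    linarith [Real.exp_pos (-(a / 2))]
  have nonneg : ∀ u v : HypSpace, 0 ≤ Real.sinh (dist u v / 2) := fun u v =>
    Real.sinh_nonneg_iff.2 (by positivity)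
  have key := sinh_ptolemy x y z w
  set m := max (dist x y + dist z w) (dist y z + dist x w) with hm
  have e1 : Real.exp ((dist x z + dist y w) / 2) / 16 ≤
      Real.sinh (dist x z / 2) * Real.sinh (dist y w / 2) := by
    have := mul_le_mul (lower _ h1) (lower _ h2) (by positivity) (nonneg _ _)
    rw [add_div, Real.exp_add]
    linarith
  have e2 : ∀ a b c d : HypSpace, dist a b + dist c d ≤ m →
      Real.sinh (dist a b / 2) * Real.sinh (dist c d / 2) ≤ Real.exp (m / 2) / 4 := by
    intro a b c d h
    have h5 := mul_le_mul (upper (dist a b)) (upper (dist c d)) (nonneg _ _) (by positivity)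
    have h6 : Real.exp (dist a b / 2) * Real.exp (dist c d / 2) ≤ Real.exp (m / 2) := by
      rw [← Real.exp_add]
      exact Real.exp_le_exp.2 (by linarith)
    linarith
  have e3 := e2 x y z w (le_max_left _ _)
  have e4 := e2 y z x w (le_max_right _ _)
  have e5 : Real.exp ((dist x z + dist y w) / 2) ≤ 8 * Real.exp (m / 2) := by linarith
  have e6 : (8 : ℝ) ≤ Real.exp (5 / 2) := by
    have h7 : Real.exp (5 / 2) ^ 2 = Real.exp 1 ^ 5 := by
      rw [← Real.exp_nat_mul, ← Real.exp_nat_mul]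
      norm_num
    have h8 : (2.7 : ℝ) ^ 5 ≤ Real.exp 1 ^ 5 :=
      pow_le_pow_left₀ (by norm_num) (by linarith [Real.exp_one_gt_d9]) 5
    rw [← abs_of_pos (Real.exp_pos (5 / 2)), ← abs_of_pos (by norm_num : (0 : ℝ) < 8),
      ← sq_le_sq, h7]
    refine le_trans ?_ h8
    norm_num
  have e7 : Real.exp ((dist x z + dist y w) / 2) ≤ Real.exp ((m + 5) / 2) := by
    rw [add_div m, Real.exp_add, mul_comm]
    exact e5.trans (mul_le_mul_of_nonneg_right e6 (Real.exp_pos _).le)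
  linarith [Real.exp_le_exp.1 e7]

theorem height_le_mul_exp (x y : HypSpace) : x.height ≤ y.height * Real.exp (dist x y) := by
  have h1 := dist_coe_le y x
  have h2 : ‖(x.coe - y.coe) 2‖ ≤ ‖x.coe - y.coe‖ := PiLp.norm_apply_le _ _
  rw [← dist_eq_norm, dist_comm, PiLp.sub_apply, Real.norm_eq_abs] at h2
  have h3 := (le_abs_self _).trans h2
  rw [dist_comm x y]
  simp only [height] at *
  linarith

/-- A hyperbolic ball lies in a Euclidean ball and stays above a positive height, hence in a compact
subset of the open half-space. -/
instance : ProperSpace HypSpace where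
  isCompact_closedBall x r := by
    rw [isInducing_coe.isCompact_iff]
    set η := x.height * Real.exp (-r) with hη
    set R := x.height * (Real.exp r - 1) with hR
    have hη0 : 0 < η := mul_pos x.height_pos (Real.exp_pos _)
    have hK : IsCompact (Metric.closedBall x.coe R ∩ {z | η ≤ z 2}) :=
      (isCompact_closedBall _ _).inter_right (isClosed_le continuous_const (by fun_prop))
    have hK2 : IsCompact (coe ⁻¹' (Metric.closedBall x.coe R ∩ {z | η ≤ z 2})) := by
      refine isInducing_coe.isCompact_preimage' hK ?_
      rintro z ⟨-, hz⟩
      exact ⟨⟨z, hη0.trans_le hz⟩, rfl⟩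
    rw [← isInducing_coe.isCompact_iff]
    refine hK2.of_isClosed_subset Metric.isClosed_closedBall ?_
    intro y hy
    rw [Metric.mem_closedBall, dist_comm] at hy
    refine ⟨?_, ?_⟩
    · rw [Metric.mem_closedBall, dist_comm]
      refine (dist_coe_le x y).trans ?_
      exact mul_le_mul_of_nonneg_left (by linarith [Real.exp_le_exp.2 hy]) x.height_pos.le
    · have h1 := height_le_mul_exp x y
      have h2 : x.height ≤ y.height * Real.exp r :=
        h1.trans (mul_le_mul_of_nonneg_left (Real.exp_le_exp.2 hy) y.height_pos.le)
      change x.height * Real.exp (-r) ≤ y.height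
      rwa [Real.exp_neg, ← div_eq_mul_inv, div_le_iff₀ (Real.exp_pos r)]

end HypSpace

/-! ### Quasigeodesics and horoballs -/

section Horoball

/-- A number that is bounded by an affine function of its binary logarithm is bounded. -/
theorem exists_forall_le_of_le_log (A B : ℝ) :
    ∃ N : ℕ, ∀ n : ℕ, (n : ℝ) ≤ A * (Nat.log 2 n + 1) + B → n ≤ N := by
  have h1 : Filter.Tendsto (fun m : ℕ => (m : ℝ) / 2 ^ m) Filter.atTop (𝓝 0) := by
    simpa using tendsto_pow_const_div_const_pow_of_one_lt 1 (one_lt_two (α := ℝ))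
  have h2 : Filter.Tendsto (fun m : ℕ => (1 : ℝ) / 2 ^ m) Filter.atTop (𝓝 0) := by
    simpa using tendsto_pow_const_div_const_pow_of_one_lt 0 (one_lt_two (α := ℝ))
  have h3 : Filter.Tendsto (fun m : ℕ => A * ((m : ℝ) / 2 ^ m) + (A + B) * (1 / 2 ^ m))
      Filter.atTop (𝓝 0) := by
    simpa using (h1.const_mul A).add (h2.const_mul (A + B))
  obtain ⟨m₀, hm₀⟩ := Filter.eventually_atTop.1 (h3.eventually (gt_mem_nhds one_pos))
  refine ⟨2 ^ m₀, fun n hn => ?_⟩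
  by_contra! hlt
  have hn0 : n ≠ 0 := by
    rintro rfl
    simp at hlt
  have h4 : m₀ ≤ Nat.log 2 n := Nat.le_log_of_pow_le one_lt_two hlt.le
  have h5 := hm₀ _ h4
  have h6 : ((2 : ℝ) ^ Nat.log 2 n) ≤ n := by exact_mod_cast Nat.pow_log_le_self 2 hn0
  have h7 : (0 : ℝ) < 2 ^ Nat.log 2 n := by positivity
  rw [mul_div_assoc', mul_div_assoc', ← add_div, div_lt_one h7] at h5
  linarith

variable {Y : Type*} [MetricSpace Y] {b : Y → ℝ} {δ : ℝ}

/-- Along a sequence with unit steps that stays outside of a horoball, the Gromov product based at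
the centre of the horoball decays at most logarithmically. -/
theorem le_gromovProduct_of_unit_steps (hδ : 0 ≤ δ)
    (h4 : ∀ w w' v, dist w w' + b v ≤ max (b w + dist w' v) (b w' + dist w v) + δ)
    {u : ℕ → Y} (hu : ∀ i, dist (u i) (u (i + 1)) ≤ 1) {H : ℝ} (m : ℕ) :
    ∀ i n : ℕ, n ≤ 2 ^ m → (∀ j ≤ n, -H ≤ b (u (i + j))) →
      -2 * H - 1 - m * δ ≤ b (u i) + b (u (i + n)) - dist (u i) (u (i + n)) := by
  induction m with
  | zero =>
    intro i n hn hb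
    have h0 := hb 0 (Nat.zero_le _)
    have hn' := hb n le_rfl
    have hd : dist (u i) (u (i + n)) ≤ 1 := by
      interval_cases n
      · simp
      · exact hu i
    simp only [add_zero] at h0
    push_cast
    linarith
  | succ m ih =>
    intro i n hn hb
    push_cast
    rcases le_total n (2 ^ m) with h | h
    · linarith [ih i n h hb]
    · have h1 := ih i (2 ^ m) le_rfl (fun j hj => hb j (hj.trans h))
      have h2 := ih (i + 2 ^ m) (n - 2 ^ m) (by rw [pow_succ] at hn; omega) (fun j hj => by
        rw [add_assoc]
        exact hb _ (by omega))
      rw [show i + 2 ^ m + (n - 2 ^ m) = i + n by omega] at h2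
      -- Gromov products based at the centre satisfy the ultrametric inequality up to `δ`, so each
      -- bisection costs one `δ`.
      have h3 := h4 (u i) (u (i + n)) (u (i + 2 ^ m))
      rw [dist_comm (u (i + n))] at h3
      rcases max_cases (b (u i) + dist (u (i + 2 ^ m)) (u (i + n)))
        (b (u (i + n)) + dist (u i) (u (i + 2 ^ m))) with ⟨h5, -⟩ | ⟨h5, -⟩ <;>
      · rw [h5] at h3
        linarith

/-- A quasigeodesic line is not contained in a horoball. The horoball is described by a function
`b` that behaves like the Busemann function of its centre. -/
theorem exists_lt_of_quasigeodesic (hδ : 0 ≤ δ) (hb : ∀ w w', b w - b w' ≤ dist w w')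
    (h4 : ∀ w w' v, dist w w' + b v ≤ max (b w + dist w' v) (b w' + dist w v) + δ)
    {γ : ℝ → Y} {k : ℝ} (hk : 1 ≤ k) (hlip : ∀ s t, dist (γ s) (γ t) ≤ |s - t|)
    (hq : ∀ s t, |s - t| ≤ k * dist (γ s) (γ t) + k) (ε : ℝ) : ∃ t, ε < b (γ t) := by
  by_contra! hε
  have growth : ∀ (s : ℝ) (n : ℕ) (H : ℝ), (∀ j ≤ n, -H ≤ b (γ (s + (j : ℕ)))) →
      (n : ℝ) ≤ (k * δ) * (Nat.log 2 n + 1) +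
        (k * (b (γ s) + b (γ (s + n)) + 2 * H + 1) + k) := by
    intro s n H hH
    have h1 := le_gromovProduct_of_unit_steps (u := fun i : ℕ => γ (s + i)) hδ h4
      (fun i => (hlip _ _).trans (by simp)) (H := H) (Nat.log 2 n + 1) 0 n
      (Nat.lt_pow_succ_log_self one_lt_two n).le (by simpa using hH)
    simp only [Nat.cast_zero, add_zero, zero_add] at h1
    have h2 := hq s (s + n)
    rw [abs_sub_comm, add_sub_cancel_left, Nat.abs_cast] at h2
    have h3 := mul_le_mul_of_nonneg_left h1 (zero_le_one.trans hk)
    push_cast at h3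
    linarith
  -- With `b` bounded above by `ε`, a lower bound along a ray would bound its length by an affine
  -- function of a logarithm. So `b` is unbounded below in both directions.
  have bounded : ∀ H : ℝ, (∀ n : ℕ, -H ≤ b (γ n)) → False := by
    intro H hH
    obtain ⟨N, hN⟩ := exists_forall_le_of_le_log (k * δ) (k * (ε + ε + 2 * H + 1) + k)
    have h1 := hN (N + 1) ((growth 0 (N + 1) H (by simpa using fun j _ => hH j)).trans ?_)
    · omega
    · have := hε 0
      have := hε (0 + (N + 1 : ℕ))
      gcongr
  have bounded' : ∀ H : ℝ, (∀ n : ℕ, -H ≤ b (γ (-n))) → False := by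
    intro H hH
    obtain ⟨N, hN⟩ := exists_forall_le_of_le_log (k * δ) (k * (ε + ε + 2 * H + 1) + k)
    have h1 := hN (N + 1) ((growth (-(N + 1 : ℕ)) (N + 1) H ?_).trans ?_)
    · omega
    · intro j hj
      have := hH (N + 1 - j)
      rw [Nat.cast_sub hj] at this
      convert this using 3
      ring
    · have := hε (-(N + 1 : ℕ))
      have := hε (-(N + 1 : ℕ) + (N + 1 : ℕ))
      gcongr
  -- `N` bounds the length of an excursion above level `-H`, whatever `H` is: the end values cancel
  -- `2 * H`, leaving the 3. Hence `H` may be chosen after `N`.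
  obtain ⟨N, hN⟩ := exists_forall_le_of_le_log (k * δ) (k * 3 + k)
  set H : ℝ := |b (γ 0)| + N with hHdef
  have h0 : -H ≤ b (γ 0) := by
    have := neg_abs_le (b (γ 0))
    have : (0 : ℝ) ≤ N := Nat.cast_nonneg N
    linarith
  -- A unit step lowers the value by at most 1, so the first value below `-H` is still at least `-(H
  -- + 1)`.
  have first : ∀ f : ℕ → ℝ, f 0 = b (γ 0) → (∀ n, f n - f (n + 1) ≤ 1) → (∃ n, f n < -H) →
      ∃ n, f n < -H ∧ ∀ j ≤ n, -(H + 1) ≤ f j := by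
    classical
    intro f hf0 hf hex
    refine ⟨Nat.find hex, Nat.find_spec hex, fun j hj => ?_⟩
    rcases hj.lt_or_eq with hj | hj
    · have := Nat.find_min hex hj
      linarith
    · rcases j with _ | j
      · linarith
      · have := Nat.find_min hex (show j < Nat.find hex by omega)
        linarith [hf j]
  obtain ⟨n₁, hn₁, hn₁'⟩ := first (fun n => b (γ n)) (by simp)
    (fun n => (hb _ _).trans ((hlip _ _).trans (by simp))) (by
      by_contra! h
      exact bounded H h)
  obtain ⟨n₂, hn₂, hn₂'⟩ := first (fun n => b (γ (-n))) (by simp)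
    (fun n => (hb _ _).trans ((hlip _ _).trans (by simp))) (by
      by_contra! h
      exact bounded' H h)
  have h1 := growth (-n₂) (n₂ + n₁) (H + 1) (by
    intro j hj
    rcases le_total j n₂ with h | h
    · have := hn₂' (n₂ - j) (by omega)
      rw [Nat.cast_sub h] at this
      convert this using 3
      ring
    · have := hn₁' (j - n₂) (by omega)
      rw [Nat.cast_sub h] at this
      convert this using 3
      ring)
  have h2 := hN (n₂ + n₁) (h1.trans (by
    have h3 : -(n₂ : ℝ) + (n₂ + n₁ : ℕ) = n₁ := by push_cast; ring
    rw [h3]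
    gcongr
    linarith))
  have h3 : b (γ 0) - b (γ n₁) ≤ n₁ := (hb _ _).trans ((hlip _ _).trans (by simp))
  have h4 : (n₁ : ℝ) ≤ N := by exact_mod_cast (by omega : n₁ ≤ N)
  linarith [neg_abs_le (b (γ 0))]

end Horoball

/-! ### Lifted flowlines are uniformly Lipschitz -/

section LiftedFlowline

variable {M : Type*} [TopologicalSpace M] {p : HypSpace → M} {X : Flow ℝ M} {c : ℝ → HypSpace}

namespace IsLiftedFlowline

theorem apply_add (hc : IsLiftedFlowline p X c) (s t : ℝ) : p (c (s + t)) = X s (p (c t)) := by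
  rw [hc.2, hc.2 t, X.map_add]

theorem comp_add_right (hc : IsLiftedFlowline p X c) (u : ℝ) :
    IsLiftedFlowline p X fun t => c (t + u) := by
  refine ⟨hc.1.comp (continuous_id.add continuous_const), fun t => ?_⟩
  change p (c (t + u)) = X t (p (c (0 + u)))
  rw [hc.apply_add, zero_add]

theorem isometry_comp (hc : IsLiftedFlowline p X c) (g : HypSpace ≃ᵢ HypSpace)
    (hg : ∀ z, p (g z) = p z) : IsLiftedFlowline p X fun t => g (c t) := by
  refine ⟨g.continuous.comp hc.1, fun t => ?_⟩
  rw [hg, hg, hc.2]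

end IsLiftedFlowline

variable [ChartedSpace (EuclideanSpace ℝ (Fin 3)) M]

/-- A ball meets each orbit of the deck group of a closed hyperbolic manifold. -/
theorem IsHyperbolicUniversalCover.exists_isometry_mem_closedBall [CompactSpace M]
    (hp : IsHyperbolicUniversalCover p) (o : HypSpace) :
    ∃ R : ℝ, ∀ z, ∃ g : HypSpace ≃ᵢ HypSpace,
      (∀ w, p (g w) = p w) ∧ g z ∈ Metric.closedBall o R := by
  obtain ⟨n, hn⟩ := (isCompact_univ (X := M)).elim_directed_cover
    (fun n : ℕ => p '' Metric.ball o n)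
    (fun n => hp.isCoveringMap.isOpenMap _ Metric.isOpen_ball) (by
      intro m _
      obtain ⟨z, rfl⟩ := hp.surjective m
      obtain ⟨n, hn⟩ := exists_nat_gt (dist z o)
      exact Set.mem_iUnion.2 ⟨n, z, hn, rfl⟩)
    (directed_of_isDirected_le fun m n hmn => Set.image_mono
      (Metric.ball_subset_ball (by exact_mod_cast hmn)))
  refine ⟨n, fun z => ?_⟩
  obtain ⟨y, hy, hyz⟩ := hn (Set.mem_univ (p z))
  obtain ⟨g, hg, hg'⟩ := hp.exists_isometry z y hyz.symm
  exact ⟨g, hg', hg ▸ Metric.ball_subset_closedBall hy⟩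

/-- A local inverse of `p` makes the lifted flow `C¹` near `(0, z)` in Euclidean coordinates, hence
Lipschitz there. Heights near `z` exceed half that of `z`, which converts the bound to the
hyperbolic metric. -/
theorem IsHyperbolicUniversalCover.exists_lipschitz_nhds (hp : IsHyperbolicUniversalCover p)
    (hX : IsC1Flow X) (z : HypSpace) :
    ∃ K : ℝ, ∃ τ : ℝ, 0 < τ ∧ ∀ᶠ y in 𝓝 z, ∀ c, IsLiftedFlowline p X c → c 0 = y →
      ∀ s t, |s| < τ → |t| < τ → dist (c s) (c t) ≤ K * |s - t| := by
  obtain ⟨Φ, hz, hΦ⟩ := hp.isLocalDiffeomorph z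
  set e := (HypSpace.isOpenEmbedding_coe.toOpenPartialHomeomorph HypSpace.coe).symm with he
  have hcoe : ∀ y : HypSpace, e y.coe = y := fun y =>
    HypSpace.isOpenEmbedding_coe.toOpenPartialHomeomorph_left_inv
  have hpz : p z = Φ z := hΦ hz
  have hpt : p z ∈ Φ.target := hpz ▸ Φ.map_source' hz
  set F : ℝ × EuclideanSpace ℝ (Fin 3) → M := fun y => X y.1 (p (e y.2)) with hF
  have hFz : F (0, z.coe) = p z := by simp [hF, hcoe]
  have hrange : Set.range HypSpace.coe ∈ 𝓝 z.coe :=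
    HypSpace.isOpenEmbedding_coe.isOpen_range.mem_nhds ⟨z, rfl⟩
  have he1 : ContMDiffAt (𝓡 3) (𝓡 3) 1 e z.coe :=
    (contMDiffOn_isOpenEmbedding_symm HypSpace.isOpenEmbedding_coe).contMDiffAt hrange
  have hF1 : ContMDiffAt (𝓘(ℝ, ℝ).prod (𝓡 3)) (𝓡 3) 1 F (0, z.coe) := by
    refine ContMDiffAt.comp (g := fun y : ℝ × M => X y.1 y.2)
      (f := fun y : ℝ × EuclideanSpace ℝ (Fin 3) => (y.1, p (e y.2))) _ (hX _) ?_
    refine contMDiffAt_fst.prodMk ?_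
    refine ContMDiffAt.comp (g := p) (f := fun y : ℝ × EuclideanSpace ℝ (Fin 3) => e y.2) _
      ((hp.isLocalDiffeomorph.contMDiff _).of_le (by norm_cast)) ?_
    exact ContMDiffAt.comp (g := e) (f := Prod.snd) _ he1 contMDiffAt_snd
  set G : ℝ × EuclideanSpace ℝ (Fin 3) → EuclideanSpace ℝ (Fin 3) :=
    fun y => (Φ.symm (F y)).coe with hG
  have hG1 : ContMDiffAt (𝓘(ℝ, ℝ).prod (𝓡 3)) (𝓡 3) 1 G (0, z.coe) := by
    refine ContMDiffAt.comp (g := fun m => (Φ.symm m).coe) (f := F) _ ?_ hF1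
    rw [hFz]
    refine ContMDiffAt.comp (g := HypSpace.coe) (f := Φ.symm) _
      (contMDiff_isOpenEmbedding HypSpace.isOpenEmbedding_coe _) ?_
    exact (Φ.symm.contMDiffOn.contMDiffAt (Φ.open_target.mem_nhds hpt)).of_le (by norm_cast)
  have hG2 : ContDiffAt ℝ 1 G (0, z.coe) := by
    rw [← contMDiffAt_iff_contDiffAt, modelWithCornersSelf_prod, ← chartedSpaceSelf_prod]
    exact hG1
  obtain ⟨K, V, hV, hKV⟩ := hG2.exists_lipschitzOnWith
  have hGz : G (0, z.coe) = z.coe := by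
    simp only [hG, hFz, hpz]
    exact congrArg _ (Φ.left_inv' hz)
  have hheight : ∀ᶠ y in 𝓝 (0, z.coe), z.height / 2 < G y 2 := by
    have h1 : ContinuousAt (fun y => G y 2) (0, z.coe) :=
      ContinuousAt.comp (g := fun w : EuclideanSpace ℝ (Fin 3) => w 2) (by fun_prop)
        hG2.continuousAt
    refine h1.eventually (lt_mem_nhds ?_)
    simp only [hGz]
    exact half_lt_self z.height_pos
  have htarget : ∀ᶠ y in 𝓝 (0, z.coe), F y ∈ Φ.target :=
    hF1.continuousAt.eventually (by rw [hFz]; exact Φ.open_target.mem_nhds hpt)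
  obtain ⟨τ, hτ, hball⟩ := Metric.eventually_nhds_iff_ball.1
    ((Filter.eventually_mem_set.2 hV).and (hheight.and htarget))
  refine ⟨K / (z.height / 2), τ, hτ, ?_⟩
  have hy : ∀ᶠ y : HypSpace in 𝓝 z, dist y.coe z.coe < τ :=
    HypSpace.continuous_coe.continuousAt.eventually (Metric.ball_mem_nhds _ hτ)
  filter_upwards [hy, Φ.open_source.mem_nhds hz] with y hyτ hyΦ c hc hcy s t hs ht
  have hmem : ∀ r : ℝ, |r| < τ → (r, y.coe) ∈ Metric.ball ((0 : ℝ), z.coe) τ := by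
    intro r hr
    rw [Metric.mem_ball, Prod.dist_eq, max_lt_iff]
    exact ⟨by simpa using hr, hyτ⟩
  have hFy : ∀ r, F (r, y.coe) = X r (p y) := fun r => by simp only [hF, hcoe]
  have hsymm : ∀ r ∈ Metric.ball (0 : ℝ) τ, X r (p y) ∈ Φ.target := fun r hr =>
    hFy r ▸ (hball _ (hmem r (by simpa using hr))).2.2
  -- Both paths lift the same flowline and agree at time 0; lifts are unique on an interval.
  have hlift : (Metric.ball (0 : ℝ) τ).EqOn c fun r => Φ.symm (X r (p y)) := by
    refine hp.isCoveringMap.eqOn_of_comp_eqOn (convex_ball _ _).isPreconnected hc.1.continuousOn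
      ?_ ?_ (Metric.mem_ball_self hτ) ?_
    · refine Φ.symm.contMDiffOn.continuousOn.comp ?_ hsymm
      exact (X.continuous continuous_id continuous_const).continuousOn
    · intro r hr
      have h1 : Φ (Φ.symm (X r (p y))) = X r (p y) := Φ.right_inv' (hsymm r hr)
      have h2 : p (Φ.symm (X r (p y))) = Φ (Φ.symm (X r (p y))) := hΦ (Φ.map_target' (hsymm r hr))
      simp only [Function.comp_apply]
      rw [h2, h1, hc.2, hcy]
    · have h1 : p y = Φ y := hΦ hyΦ
      simp only [Flow.map_zero_apply, h1, hcy]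
      exact (Φ.left_inv' hyΦ).symm
  have hcG : ∀ r, |r| < τ → (c r).coe = G (r, y.coe) := by
    intro r hr
    simp only [hG, hFy]
    rw [hlift (by simpa using hr)]
  have hh : ∀ r, |r| < τ → z.height / 2 ≤ (c r).height := by
    intro r hr
    have := (hball _ (hmem r hr)).2.1
    rw [← hcG r hr] at this
    exact this.le
  have hz0 : 0 < z.height / 2 := half_pos z.height_pos
  have hd : dist (c s).coe (c t).coe ≤ K * |s - t| := by
    rw [hcG s hs, hcG t ht]
    refine (hKV.dist_le_mul _ (hball _ (hmem s hs)).1 _ (hball _ (hmem t ht)).1).trans_eq ?_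
    simp [Prod.dist_eq, Real.dist_eq]
  have hsq : z.height / 2 ≤ √((c s).height * (c t).height) := by
    refine Real.le_sqrt_of_sq_le ?_
    rw [sq]
    exact mul_le_mul (hh s hs) (hh t ht) hz0.le (hz0.le.trans (hh s hs))
  calc dist (c s) (c t) ≤ dist (c s).coe (c t).coe / √((c s).height * (c t).height) :=
        HypSpace.dist_le_dist_coe_div _ _
    _ ≤ (K * |s - t|) / (z.height / 2) := by gcongr
    _ = _ := by ring

/-- The lifted flowlines of a `C¹` flow on a closed manifold are uniformly Lipschitz. -/
theorem IsHyperbolicUniversalCover.exists_lipschitz [CompactSpace M]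
    (hp : IsHyperbolicUniversalCover p) (hX : IsC1Flow X) :
    ∃ K : ℝ, 0 < K ∧ ∀ c, IsLiftedFlowline p X c → ∀ s t, dist (c s) (c t) ≤ K * |s - t| := by
  obtain ⟨R, hR⟩ := hp.exists_isometry_mem_closedBall (Classical.arbitrary HypSpace)
  obtain ⟨K, τ, hτ, hK⟩ : ∃ K : ℝ, ∃ τ : ℝ, 0 < τ ∧
      ∀ y ∈ Metric.closedBall (Classical.arbitrary HypSpace) R, ∀ c, IsLiftedFlowline p X c →
        c 0 = y → ∀ s t, |s| < τ → |t| < τ → dist (c s) (c t) ≤ K * |s - t| := by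
    refine (isCompact_closedBall (Classical.arbitrary HypSpace) R).induction_on
      (p := fun S => ∃ K : ℝ, ∃ τ : ℝ, 0 < τ ∧ ∀ y ∈ S, ∀ c, IsLiftedFlowline p X c →
        c 0 = y → ∀ s t, |s| < τ → |t| < τ → dist (c s) (c t) ≤ K * |s - t|) ?_ ?_ ?_ ?_
    · exact ⟨0, 1, one_pos, by simp⟩
    · rintro S T hST ⟨K, τ, hτ, h⟩
      exact ⟨K, τ, hτ, fun y hy => h y (hST hy)⟩
    · rintro S T ⟨K₁, τ₁, hτ₁, h₁⟩ ⟨K₂, τ₂, hτ₂, h₂⟩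
      refine ⟨max K₁ K₂, min τ₁ τ₂, lt_min hτ₁ hτ₂, ?_⟩
      rintro y (hy | hy) c hc hcy s t hs ht
      · exact (h₁ y hy c hc hcy s t (hs.trans_le (min_le_left _ _))
          (ht.trans_le (min_le_left _ _))).trans
            (mul_le_mul_of_nonneg_right (le_max_left _ _) (abs_nonneg _))
      · exact (h₂ y hy c hc hcy s t (hs.trans_le (min_le_right _ _))
          (ht.trans_le (min_le_right _ _))).trans
            (mul_le_mul_of_nonneg_right (le_max_right _ _) (abs_nonneg _))
    · intro z _
      obtain ⟨K, τ, hτ, h⟩ := hp.exists_lipschitz_nhds hX z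
      exact ⟨_, mem_nhdsWithin_of_mem_nhds h, K, τ, hτ, fun y hy => hy⟩
  refine ⟨max K 1, lt_max_of_lt_right one_pos, fun c hc => ?_⟩
  have local_bound : ∀ s t, |s - t| < τ → dist (c s) (c t) ≤ max K 1 * |s - t| := by
    intro s t hst
    obtain ⟨g, hg, hgc⟩ := hR (c s)
    have h1 := hK _ hgc _ ((hc.comp_add_right s).isometry_comp g hg) (by simp) 0 (t - s)
      (by simpa using hτ) (by rwa [abs_sub_comm])
    simp only [zero_add, sub_add_cancel, g.isometry.dist_eq, zero_sub, neg_sub] at h1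
    exact h1.trans (mul_le_mul_of_nonneg_right (le_max_left _ _) (abs_nonneg _))
  -- Passing through the midpoint doubles the time range without changing the constant.
  have key : ∀ n : ℕ, ∀ s t, |s - t| < 2 ^ n * τ → dist (c s) (c t) ≤ max K 1 * |s - t| := by
    intro n
    induction n with
    | zero => simpa using local_bound
    | succ n ih =>
      intro s t hst
      have e1 : |s - (s + t) / 2| = |s - t| / 2 := by
        rw [show s - (s + t) / 2 = (s - t) / 2 by ring, abs_div, abs_two]
      have e2 : |(s + t) / 2 - t| = |s - t| / 2 := by
        rw [show (s + t) / 2 - t = (s - t) / 2 by ring, abs_div, abs_two]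
      rw [pow_succ] at hst
      have h1 := ih s ((s + t) / 2) (by rw [e1]; linarith)
      have h2 := ih ((s + t) / 2) t (by rw [e2]; linarith)
      rw [e1] at h1
      rw [e2] at h2
      linarith [dist_triangle (c s) (c ((s + t) / 2)) (c t)]
  intro s t
  obtain ⟨n, hn⟩ := pow_unbounded_of_one_lt (|s - t| / τ) one_lt_two
  exact key n s t ((div_lt_iff₀ hτ).1 hn)

end LiftedFlowline

/-! ### Uniform constants -/

section Curve

variable {Y : Type*} [MetricSpace Y] {c : ℝ → Y} {γ : ℝ → Y}

theorem edist_le_curveDist (c : ℝ → Y) (x y : Y) : edist x y ≤ curveDist c x y := by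
  refine le_iInf fun s => le_iInf fun hs => le_iInf fun t => le_iInf fun ht => ?_
  rw [← hs, ← ht]
  exact eVariationOn.edist_le _ Set.left_mem_uIcc Set.right_mem_uIcc

theorem dist_le_of_curveDist_eq (h : ∀ a b : ℝ, curveDist c (γ a) (γ b) = ENNReal.ofReal |a - b|)
    (a b : ℝ) : dist (γ a) (γ b) ≤ |a - b| := by
  have h1 := edist_le_curveDist c (γ a) (γ b)
  rw [h, edist_dist] at h1
  exact (ENNReal.ofReal_le_ofReal_iff (abs_nonneg _)).1 h1

theorem curveDist_le_of_lipschitz {K : ℝ} (hK : 0 ≤ K)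
    (hc : ∀ s t, dist (c s) (c t) ≤ K * |s - t|) (s t : ℝ) :
    curveDist c (c s) (c t) ≤ ENNReal.ofReal (K * |s - t|) := by
  have h1 : curveDist c (c s) (c t) ≤ eVariationOn c (Set.uIcc s t) :=
    iInf_le_of_le s (iInf_le_of_le rfl (iInf_le_of_le t (iInf_le_of_le rfl le_rfl)))
  refine h1.trans ?_
  have hL : LipschitzWith K.toNNReal c := LipschitzWith.of_dist_le_mul fun s t => by
    rw [Real.coe_toNNReal K hK, Real.dist_eq]
    exact hc s t
  have h2 : eVariationOn (c ∘ id) (Set.uIcc s t) ≤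
      K.toNNReal * eVariationOn (id : ℝ → ℝ) (Set.uIcc s t) :=
    (hL.lipschitzOnWith (s := Set.univ)).comp_eVariationOn_le (fun _ _ => Set.mem_univ _)
  refine h2.trans ?_
  have h3 : eVariationOn (id : ℝ → ℝ) (Set.uIcc s t) ≤ ENNReal.ofReal |s - t| := by
    have h4 := (monotone_id (α := ℝ)).monotoneOn (Set.uIcc s t) |>.eVariationOn_eq
      (a := min s t) (b := max s t) ⟨le_rfl, min_le_max⟩ ⟨min_le_max, le_rfl⟩
    rw [Set.uIcc, Set.inter_self, id, id, max_sub_min_eq_abs, abs_sub_comm] at h4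
    exact h4.le
  rw [ENNReal.ofReal_mul hK]
  exact mul_le_mul_right h3 _

/-- The range of a quasigeodesic is unbounded. -/
theorem IsQuasigeodesicCurve.exists_lt_dist {k : ℝ} (hc : IsQuasigeodesicCurve k c) (R : ℝ) :
    ∃ s t, R < dist (c s) (c t) := by
  obtain ⟨γ, hγ, -, hk, hq⟩ := hc
  -- The additive error uses up `k`, leaving `k * |R| + 1 ≤ k * dist`.
  obtain ⟨s, hs⟩ : γ (k * |R| + k + 1) ∈ Set.range c := hγ ▸ Set.mem_range_self _
  obtain ⟨t, ht⟩ : γ 0 ∈ Set.range c := hγ ▸ Set.mem_range_self _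
  refine ⟨s, t, ?_⟩
  rw [hs, ht]
  have h1 := (hq (k * |R| + k + 1) 0).2
  have hk0 : 0 < k := by linarith
  rw [Real.dist_eq, sub_zero, abs_of_pos (by positivity)] at h1
  have h2 : k * |R| < k * dist (γ (k * |R| + k + 1)) (γ 0) := by linarith
  exact (le_abs_self R).trans_lt (lt_of_mul_lt_mul_left h2 hk0.le)

end Curve

/-! ### Limits of flowlines and the resulting uniform bounds -/

section Limits

variable {M : Type*} [TopologicalSpace M] [T2Space M] [CompactSpace M]
  [ChartedSpace (EuclideanSpace ℝ (Fin 3)) M] {p : HypSpace → M} {X : Flow ℝ M}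

open Filter

/-- Up to deck transformations, lifted flowlines subconverge to lifted flowlines. -/
theorem IsHyperbolicUniversalCover.exists_limit_flowline (hp : IsHyperbolicUniversalCover p)
    (hX : IsC1Flow X) {c : ℕ → ℝ → HypSpace} (hc : ∀ n, IsLiftedFlowline p X (c n)) :
    ∃ (g : ℕ → HypSpace ≃ᵢ HypSpace) (l : ℝ → HypSpace), IsLiftedFlowline p X l ∧
      ∀ t, Tendsto (fun n => g n (c n t)) (hyperfilter ℕ) (𝓝 (l t)) := by
  set o : HypSpace := Classical.arbitrary HypSpace
  obtain ⟨R, hR⟩ := hp.exists_isometry_mem_closedBall o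
  obtain ⟨K, hK0, hK⟩ := hp.exists_lipschitz hX
  choose g hg hgR using fun n => hR (c n 0)
  have hgc : ∀ n, IsLiftedFlowline p X fun t => g n (c n t) := fun n =>
    (hc n).isometry_comp (g n) (hg n)
  -- For each `t` the points stay in a compact ball; the fixed ultrafilter gives limits for all `t`
  -- at once, with no diagonal subsequence.
  have hlim : ∀ t, ∃ z, Tendsto (fun n => g n (c n t)) (hyperfilter ℕ) (𝓝 z) := by
    intro t
    obtain ⟨z, -, hz⟩ := (isCompact_closedBall o (R + K * |t|)).ultrafilter_le_nhds'
      ((hyperfilter ℕ).map fun n => g n (c n t)) (by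
        refine Ultrafilter.mem_coe.1 (Filter.mem_map.2 (Filter.univ_mem' fun n => ?_))
        have h1 := hK _ (hgc n) t 0
        have h2 := hgR n
        rw [sub_zero] at h1
        rw [Metric.mem_closedBall] at h2
        change dist _ _ ≤ _
        linarith [dist_triangle (g n (c n t)) (g n (c n 0)) o])
    exact ⟨z, hz⟩
  choose l hl using hlim
  refine ⟨g, l, ⟨?_, fun t => ?_⟩, hl⟩
  · refine (LipschitzWith.of_dist_le_mul (K := K.toNNReal) fun s t => ?_).continuous
    rw [Real.coe_toNNReal K hK0.le, Real.dist_eq]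
    exact le_of_tendsto' ((hl s).dist (hl t)) fun n => hK _ (hgc n) s t
  · have h1 := (hp.isCoveringMap.continuous.tendsto (l t)).comp (hl t)
    have hXt : Continuous fun m => X t m := X.continuous continuous_const continuous_id
    have h2 := ((hXt.comp hp.isCoveringMap.continuous).tendsto (l 0)).comp (hl 0)
    refine tendsto_nhds_unique h1 (h2.congr fun n => ?_)
    simp only [Function.comp_apply, hg, (hc n).2 t]

/-- A function that behaves like the Busemann function of a limit of the points `x n`. -/
theorem HypSpace.exists_busemann (x : ℕ → HypSpace) (o : HypSpace) :
    ∃ b : HypSpace → ℝ,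
      (∀ w, Tendsto (fun n => dist (x n) w - dist (x n) o) (hyperfilter ℕ) (𝓝 (b w))) ∧
      (∀ w w', b w - b w' ≤ dist w w') ∧
      ∀ w w' v, dist w w' + b v ≤ max (b w + dist w' v) (b w' + dist w v) + 5 := by
  have hlim : ∀ w, ∃ r, Tendsto (fun n => dist (x n) w - dist (x n) o) (hyperfilter ℕ) (𝓝 r) := by
    intro w
    obtain ⟨r, -, hr⟩ := (isCompact_Icc (a := -dist w o) (b := dist w o)).ultrafilter_le_nhds'
      ((hyperfilter ℕ).map fun n => dist (x n) w - dist (x n) o) (by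
        refine Ultrafilter.mem_coe.1 (Filter.mem_map.2 (Filter.univ_mem' fun n => ?_))
        change -_ ≤ _ ∧ _ ≤ _
        have h1 := dist_triangle (x n) w o
        have h2 := dist_triangle (x n) o w
        rw [dist_comm o w] at h2
        constructor <;> linarith)
    exact ⟨r, hr⟩
  choose b hb using hlim
  refine ⟨b, hb, fun w w' => ?_, fun w w' v => ?_⟩
  · refine le_of_tendsto' ((hb w).sub (hb w')) fun n => ?_
    have h2 := dist_triangle (x n) w' w
    rw [dist_comm w' w] at h2
    linarith
  · refine le_of_tendsto_of_tendsto' ((hb v).const_add (dist w w'))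
      ((((hb w).add_const (dist w' v)).max ((hb w').add_const (dist w v))).add_const 5) fun n => ?_
    have h1 := HypSpace.four_point w (x n) w' v
    rw [dist_comm w (x n)] at h1
    rcases max_cases (dist (x n) w + dist w' v) (dist (x n) w' + dist w v) with ⟨h, -⟩ | ⟨h, -⟩
    · rw [h] at h1
      linarith [le_max_left (dist (x n) w - dist (x n) o + dist w' v)
        (dist (x n) w' - dist (x n) o + dist w v)]
    · rw [h] at h1
      linarith [le_max_right (dist (x n) w - dist (x n) o + dist w' v)
        (dist (x n) w' - dist (x n) o + dist w v)]

/-- This keeps the limit flowline in a horoball: `x` and `y` are the ends of a segment, `z` the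
maximizing point and `w` another point of the segment, close to `z` relative to the Gromov product.
-/
theorem HypSpace.dist_le_add_of_gromovProduct {x y z w : HypSpace}
    (h1 : dist x w + dist y w ≤ dist x z + dist y z)
    (h2 : dist x y + dist w z ≤ dist x z + dist y z) : dist x w ≤ dist x z + 5 := by
  have h := four_point x y w z
  rcases max_cases (dist x y + dist w z) (dist y w + dist x z) with ⟨h', -⟩ | ⟨h', -⟩ <;>
  · rw [h'] at h
    linarith

/-- Segments of lifted flowlines are uniformly close to geodesics. -/
theorem IsHyperbolicUniversalCover.exists_gromovProduct_le (hp : IsHyperbolicUniversalCover p)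
    (hX : IsC1Flow X) (hq : IsQuasigeodesicFlow p X) :
    ∃ C : ℝ, ∀ c, IsLiftedFlowline p X c → ∀ s u t, s ≤ u → u ≤ t →
      dist (c s) (c u) + dist (c t) (c u) ≤ dist (c s) (c t) + C := by
  by_contra! hcon
  obtain ⟨K, hK0, hK⟩ := hp.exists_lipschitz hX
  have step : ∀ n : ℕ, ∃ c, IsLiftedFlowline p X c ∧ ∃ s t, s ≤ 0 ∧ 0 ≤ t ∧
      (∀ r ∈ Set.Icc s t, dist (c s) (c r) + dist (c t) (c r) ≤
        dist (c s) (c 0) + dist (c t) (c 0)) ∧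
      dist (c s) (c t) + n < dist (c s) (c 0) + dist (c t) (c 0) := by
    intro n
    obtain ⟨c, hc, s, u, t, hsu, hut, h⟩ := hcon n
    have hcont : ContinuousOn (fun r => dist (c s) (c r) + dist (c t) (c r)) (Set.Icc s t) :=
      ((continuous_const.dist hc.1).add (continuous_const.dist hc.1)).continuousOn
    obtain ⟨v, hv, hmax⟩ := isCompact_Icc.exists_isMaxOn ⟨u, hsu, hut⟩ hcont
    refine ⟨_, hc.comp_add_right v, s - v, t - v, by linarith [hv.1], by linarith [hv.2], ?_, ?_⟩
    · intro r hr
      simpa using hmax (show r + v ∈ Set.Icc s t from ⟨by linarith [hr.1], by linarith [hr.2]⟩)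
    · have h1 : dist (c s) (c u) + dist (c t) (c u) ≤ dist (c s) (c v) + dist (c t) (c v) :=
        hmax ⟨hsu, hut⟩
      simp only [sub_add_cancel, zero_add]
      linarith
  choose c hc s t hs ht hmax hfar using step
  obtain ⟨g, l, hl, hgl⟩ := hp.exists_limit_flowline hX hc
  obtain ⟨b, hb, hb1, hb4⟩ := HypSpace.exists_busemann (fun n => g n (c n (s n))) (l 0)
  have horoball : ∀ r, b (l r) ≤ 5 := by
    intro r
    have h1 : Tendsto (fun n => 5 + dist (g n (c n r)) (l r) + dist (g n (c n 0)) (l 0))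
        (hyperfilter ℕ) (𝓝 (5 + 0 + 0)) :=
      ((tendsto_iff_dist_tendsto_zero.1 (hgl r)).const_add 5).add
        (tendsto_iff_dist_tendsto_zero.1 (hgl 0))
    rw [add_zero, add_zero] at h1
    refine le_of_tendsto_of_tendsto (hb (l r)) h1 ?_
    -- The factor 2 ensures that the time `r` lies in the `n`-th segment: each end is at distance
    -- more than `n / 2` from the centre.
    have h2 : ∀ᶠ n : ℕ in hyperfilter ℕ, 2 * K * |r| ≤ n :=
      (Nat.hyperfilter_le_atTop) (tendsto_natCast_atTop_atTop.eventually_ge_atTop _)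
    filter_upwards [h2] with n hn
    have h3 := hK _ (hc n) (s n) 0
    have h4 := hK _ (hc n) (t n) 0
    rw [sub_zero, abs_of_nonpos (hs n)] at h3
    rw [sub_zero, abs_of_nonneg (ht n)] at h4
    have h5 := hfar n
    have h6 := dist_triangle (c n (s n)) (c n (t n)) (c n 0)
    have h7 := dist_triangle (c n (t n)) (c n (s n)) (c n 0)
    rw [dist_comm (c n (t n)) (c n (s n))] at h7
    have h8 : |r| ≤ -s n := le_of_mul_le_mul_left (by linarith) hK0
    have h9 : |r| ≤ t n := le_of_mul_le_mul_left (by linarith) hK0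
    have h10 := hmax n r ⟨by linarith [neg_abs_le r], (le_abs_self r).trans h9⟩
    have h11 := hK _ (hc n) r 0
    rw [sub_zero] at h11
    have h12 : 0 ≤ K * |r| := by positivity
    have h13 := HypSpace.dist_le_add_of_gromovProduct h10 (by linarith)
    have h14 := dist_triangle (g n (c n (s n))) (g n (c n r)) (l r)
    have h15 := dist_triangle (g n (c n (s n))) (l 0) (g n (c n 0))
    rw [(g n).isometry.dist_eq] at h14 h15
    rw [dist_comm (l 0)] at h15
    linarith
  obtain ⟨k, γ, hγ, hγc, hk, hγq⟩ := hq l hl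
  obtain ⟨a, ha⟩ := exists_lt_of_quasigeodesic (by norm_num) hb1 hb4 hk
    (dist_le_of_curveDist_eq hγc) (fun a a' => (hγq a a').2) 5
  obtain ⟨r, hr⟩ : γ a ∈ Set.range l := hγ ▸ Set.mem_range_self a
  rw [← hr] at ha
  exact ha.not_ge (horoball r)

/-- Lifted flowlines are uniformly proper. -/
theorem IsHyperbolicUniversalCover.exists_lt_dist (hp : IsHyperbolicUniversalCover p)
    (hX : IsC1Flow X) (hq : IsQuasigeodesicFlow p X) (R : ℝ) :
    ∃ T : ℝ, 0 < T ∧ ∀ c, IsLiftedFlowline p X c → ∀ s t, s + T ≤ t → R < dist (c s) (c t) := by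
  by_contra! hcon
  obtain ⟨C, hC⟩ := hp.exists_gromovProduct_le hX hq
  have step : ∀ n : ℕ, ∃ c, IsLiftedFlowline p X c ∧
      ∀ r r' : ℝ, |r| ≤ n → |r'| ≤ n → dist (c r) (c r') ≤ 2 * (R + C) := by
    intro n
    -- The times within `n` of `s + n` lie in `[s, t]`; the extra 1 keeps the length positive for `n
    -- = 0`.
    obtain ⟨c, hc, s, t, hst, h⟩ := hcon (2 * n + 1) (by positivity)
    refine ⟨_, hc.comp_add_right (s + n), fun r r' hr hr' => ?_⟩
    have bound : ∀ r : ℝ, |r| ≤ n → dist (c s) (c (r + (s + n))) ≤ R + C := by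
      intro r hr
      have h1 := abs_le.1 hr
      have h2 := hC c hc s (r + (s + n)) t (by linarith) (by linarith)
      linarith [dist_nonneg (x := c t) (y := c (r + (s + n)))]
    linarith [dist_triangle_left (c (r + (s + n))) (c (r' + (s + n))) (c s), bound r hr,
      bound r' hr']
  choose c hc hbd using step
  obtain ⟨g, l, hl, hgl⟩ := hp.exists_limit_flowline hX hc
  obtain ⟨k, hk⟩ := hq l hl
  obtain ⟨r, r', hr⟩ := hk.exists_lt_dist (2 * (R + C))
  refine hr.not_ge (le_of_tendsto ((hgl r).dist (hgl r')) ?_)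
  have h2 : ∀ᶠ n : ℕ in hyperfilter ℕ, max |r| |r'| ≤ n :=
    (Nat.hyperfilter_le_atTop) (tendsto_natCast_atTop_atTop.eventually_ge_atTop _)
  filter_upwards [h2] with n hn
  rw [(g n).isometry.dist_eq]
  exact hbd n r r' ((le_max_left _ _).trans hn) ((le_max_right _ _).trans hn)

/-- The time between two points of a lifted flowline is bounded by an affine function of their
distance. -/
theorem IsHyperbolicUniversalCover.exists_abs_sub_le (hp : IsHyperbolicUniversalCover p)
    (hX : IsC1Flow X) (hq : IsQuasigeodesicFlow p X) :
    ∃ A B : ℝ, 0 ≤ A ∧ ∀ c, IsLiftedFlowline p X c → ∀ s t,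
      |s - t| ≤ A * dist (c s) (c t) + B := by
  obtain ⟨C, hC⟩ := hp.exists_gromovProduct_le hX hq
  -- In the four point condition `C` cancels against the Gromov product bound and 5 is lost, so
  -- distances from the start differ by more than 1 and have distinct floors.
  obtain ⟨T, hT0, hT⟩ := hp.exists_lt_dist hX hq (C + 6)
  refine ⟨T, T * (C + 2), hT0.le, fun c hc => ?_⟩
  have key : ∀ s t, s ≤ t → t - s ≤ T * dist (c s) (c t) + T * (C + 2) := by
    intro s t hst
    set n := ⌊(t - s) / T⌋₊ with hn
    have hnT : n * T ≤ t - s := by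
      rw [← le_div_iff₀ hT0]
      exact Nat.floor_le (div_nonneg (by linarith) hT0.le)
    have hnT' : t - s < (n + 1) * T := by
      rw [← div_lt_iff₀ hT0]
      exact Nat.lt_floor_add_one _
    set u : ℕ → ℝ := fun j => s + j * T with hu
    have hmem : ∀ j ∈ Finset.range (n + 1), s ≤ u j ∧ u j ≤ t := by
      intro j hj
      have h1 : (j : ℝ) ≤ n := by exact_mod_cast Nat.lt_succ_iff.1 (Finset.mem_range.1 hj)
      have h2 := mul_le_mul_of_nonneg_right h1 hT0.le
      have h3 : (0 : ℝ) ≤ j * T := by positivity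
      simp only [hu]
      constructor <;> linarith
    have hproj : ∀ j ∈ Finset.range (n + 1),
        dist (c s) (c (u j)) + dist (c t) (c (u j)) ≤ dist (c s) (c t) + C := fun j hj =>
      hC c hc s (u j) t (hmem j hj).1 (hmem j hj).2
    have hsep : ∀ i ∈ Finset.range (n + 1), ∀ j ∈ Finset.range (n + 1), i < j →
        1 < |dist (c s) (c (u i)) - dist (c s) (c (u j))| := by
      intro i hi j hj hij
      have h1 : (i : ℝ) + 1 ≤ j := by exact_mod_cast hij
      have h2 := mul_le_mul_of_nonneg_right h1 hT0.le
      have h3 := hT c hc (u i) (u j) (by simp only [hu]; linarith)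
      have h4 := HypSpace.four_point (c s) (c (u i)) (c t) (c (u j))
      have h5 := hproj i hi
      have h6 := hproj j hj
      rw [dist_comm (c (u i)) (c t)] at h4
      rcases max_cases (dist (c s) (c (u i)) + dist (c t) (c (u j)))
        (dist (c t) (c (u i)) + dist (c s) (c (u j))) with ⟨h, -⟩ | ⟨h, -⟩
      · rw [h] at h4
        rw [abs_sub_comm]
        exact lt_of_lt_of_le (by linarith) (neg_le_abs _)
      · rw [h] at h4
        rw [abs_sub_comm]
        exact lt_of_lt_of_le (by linarith) (le_abs_self _)
    have hcard := Finset.card_le_card_of_injOn (s := Finset.range (n + 1))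
      (t := Finset.range (⌊dist (c s) (c t) + C⌋₊ + 1)) (fun j => ⌊dist (c s) (c (u j))⌋₊) (by
        intro j hj
        have := hproj j hj
        refine Finset.mem_coe.2 (Finset.mem_range.2 (Nat.lt_succ_of_le (Nat.floor_mono ?_)))
        linarith [dist_nonneg (x := c t) (y := c (u j))]) (by
        have hinj : ∀ i ∈ Finset.range (n + 1), ∀ j ∈ Finset.range (n + 1), i < j →
            ⌊dist (c s) (c (u i))⌋₊ ≠ ⌊dist (c s) (c (u j))⌋₊ := by
          intro i hi j hj hij h
          have h1 := hsep i hi j hj hij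
          have h2 := Nat.floor_le (dist_nonneg (x := c s) (y := c (u i)))
          have h3 := Nat.floor_le (dist_nonneg (x := c s) (y := c (u j)))
          have h4 := Nat.lt_floor_add_one (dist (c s) (c (u i)))
          have h5 := Nat.lt_floor_add_one (dist (c s) (c (u j)))
          rw [h] at h2 h4
          exact h1.not_gt (abs_sub_lt_iff.2 ⟨by linarith, by linarith⟩)
        intro i hi j hj h
        rcases lt_trichotomy i j with hij | hij | hij
        · exact absurd h (hinj i hi j hj hij)
        · exact hij
        · exact absurd h.symm (hinj j hj i hi hij))
    rw [Finset.card_range, Finset.card_range] at hcard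
    have h0 : 0 ≤ dist (c s) (c t) + C := by
      have := hproj 0 (by simp)
      exact (add_nonneg dist_nonneg dist_nonneg).trans this
    have h1 : (n : ℝ) ≤ dist (c s) (c t) + C :=
      le_trans (by exact_mod_cast Nat.le_of_succ_le_succ hcard) (Nat.floor_le h0)
    nlinarith
  intro s t
  rcases le_total s t with h | h
  · rw [abs_sub_comm, abs_of_nonneg (by linarith)]
    exact key s t h
  · rw [abs_of_nonneg (by linarith), dist_comm]
    exact key t s h

end Limits

theorem mainTheorem7 {M : Type*} [TopologicalSpace M] [T2Space M] [CompactSpace M]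
    [ChartedSpace (EuclideanSpace ℝ (Fin 3)) M] [IsManifold (𝓡 3) ∞ M]
    (p : HypSpace → M) (hp : IsHyperbolicUniversalCover p)
    (X : Flow ℝ M) (hX : IsC1Flow X) (hq : IsQuasigeodesicFlow p X) :
    IsUniformlyQuasigeodesicFlow p X := by
  obtain ⟨K, hK0, hK⟩ := hp.exists_lipschitz hX
  obtain ⟨A, B, hA, hAB⟩ := hp.exists_abs_sub_le hX hq
  set k := max 1 (max (K * A) (K * B)) with hk
  have hk1 : 1 ≤ k := le_max_left _ _
  have hkA : K * A ≤ k := (le_max_left _ _).trans (le_max_right _ _)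
  have hkB : K * B ≤ k := (le_max_right _ _).trans (le_max_right _ _)
  refine ⟨k, fun c hc => ?_⟩
  -- The arclength parametrization is kept; only its constant is replaced.
  obtain ⟨_, γ, hγ, hγc, -⟩ := hq c hc
  refine ⟨γ, hγ, hγc, hk1, fun a b => ?_⟩
  have hlip := dist_le_of_curveDist_eq hγc a b
  rw [Real.dist_eq]
  constructor
  · have h1 : 1 / k * dist (γ a) (γ b) ≤ 1 * dist (γ a) (γ b) :=
      mul_le_mul_of_nonneg_right (div_le_one_of_le₀ hk1 (by linarith)) dist_nonneg
    linarith
  · obtain ⟨s, hs⟩ : γ a ∈ Set.range c := hγ ▸ Set.mem_range_self a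
    obtain ⟨t, ht⟩ : γ b ∈ Set.range c := hγ ▸ Set.mem_range_self b
    have h1 := curveDist_le_of_lipschitz hK0.le (hK c hc) s t
    rw [hs, ht, hγc, ENNReal.ofReal_le_ofReal_iff (by positivity)] at h1
    have h2 := mul_le_mul_of_nonneg_left (hAB c hc s t) hK0.le
    rw [hs, ht] at h2
    have h3 := mul_le_mul_of_nonneg_right hkA (dist_nonneg (x := γ a) (y := γ b))
    linarith
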